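/- Let $K$ be a field and let $I\neq 0$ be a squarefree monomial ideal of $S=K[x_1,\dots,x_n]$ whose minimal monomial generators $f_1,\dots,f_m$ all have the same degree $d\ge 1$. Let $R=K[x_1,\dots,x_n,y_1,\dots,y_m]$, let $M$ be the highest exponent with which a variable occurs in $f_1,\dots,f_m$ (so $M=1$), and let $$\mathrm{LIN}(I)=\big(x_1^{a_1}\cdots x_n^{a_n}\mid a_1+\dots+a_n=d,\ a_k\le M\text{ for all }k\big)+\big(f_jy_j/x_k\mid 1\le j\le m,\ 1\le k\le n,\ x_k\text{ divides }f_j\big)\subseteq R .$$ A $(d-1)$-edge of $I$ is a squarefree monomial of degree $d-1$ in $S$ that divides some $f_j$. A $j$-cluster is a set of exactly $j$ of the generators $f_1,\dots,f_m$ that are all divisible by a same $(d-1)$-edge, and $C_j$ denotes the number of $j$-clusters that are not contained in a $(j+1)$-cluster. Let $\beta_i(\mathrm{LIN}(I))$ be the $i$-th total Betti number, that is, the rank of the $i$-th module $F_i$ in a minimal graded free resolution $\cdots\to F_1\to F_0\to \mathrm{LIN}(I)\to 0$ over $R$ with its standard grading. Then for all $i\ge 0$ $$\beta_i\big(\mathrm{LIN}(I)\big)=\binom{i+d-1}{d-1}\binom{n}{i+d}+\binom{n-d+1}{i}\Big(md-\sum_{j\ge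 2}(j-1)C_j\Big)+\sum_{j\ge 2}C_j\sum_{k=2}^{j}\binom{n-d+k}{i}.$$ -/

import Mathlib

open MvPolynomial

noncomputable section

namespace StarLinearization

/-! ### Monomial ideals. A monomial is represented by its exponent vector; divisibility of
monomials is then the pointwise order on exponent vectors. -/

/-- An ideal generated by a set of monomials. -/
def IsMonomialIdeal {σ K : Type*} [Field K] (I : Ideal (MvPolynomial σ K)) : Prop :=
  ∃ S : Set (σ →₀ ℕ), I = Ideal.span ((fun s => monomial s (1 : K)) '' S)

/-- `G(I)`: the monomials in `I` that are minimal with respect to divisibility. -/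
def minGens {σ K : Type*} [Field K] (I : Ideal (MvPolynomial σ K)) : Set (σ →₀ ℕ) :=
  {s | Minimal (fun t : σ →₀ ℕ => monomial t (1 : K) ∈ I) s}

/-- A squarefree monomial. -/
def IsSquarefreeMonomial {σ : Type*} (s : σ →₀ ℕ) : Prop := ∀ k, s k ≤ 1

/-! ### The `*`-linearization -/

/-- The highest exponent with which a variable occurs in one of the monomials `f j`. -/
def maxExponent {n m : ℕ} (f : Fin m → (Fin n →₀ ℕ)) : ℕ :=
  Finset.univ.sup fun j => Finset.univ.sup fun k => f j k

/-- The complete part: all monomials of degree `d` in `x₁, …, xₙ` with exponents at most `M`.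
In `Fin n ⊕ Fin m`, `Sum.inl k` is the variable `x_k` and `Sum.inr j` the variable `y_j`. -/
def completePart (K : Type*) [Field K] {n m : ℕ} (d : ℕ) (f : Fin m → (Fin n →₀ ℕ)) :
    Ideal (MvPolynomial (Fin n ⊕ Fin m) K) :=
  Ideal.span {p | ∃ a : Fin n →₀ ℕ, a.degree = d ∧ (∀ k, a k ≤ maxExponent f) ∧
    p = monomial (a.mapDomain Sum.inl) 1}

/-- The last part: the monomials `f_j y_j / x_k` with `x_k` dividing `f_j`. -/
def lastPart (K : Type*) [Field K] {n m : ℕ} (f : Fin m → (Fin n →₀ ℕ)) :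
    Ideal (MvPolynomial (Fin n ⊕ Fin m) K) :=
  Ideal.span {p | ∃ (j : Fin m) (k : Fin n), k ∈ (f j).support ∧
    p = monomial ((f j - Finsupp.single k 1).mapDomain Sum.inl +
      Finsupp.single (Sum.inr j) 1) 1}

/-- The `*`-linearization, in `K[x₁, …, xₙ, y₁, …, yₘ]`, of the ideal with minimal monomial
generators `f 0, …, f (m - 1)`, all of degree `d`. -/
def LIN (K : Type*) [Field K] {n m : ℕ} (d : ℕ) (f : Fin m → (Fin n →₀ ℕ)) :
    Ideal (MvPolynomial (Fin n ⊕ Fin m) K) :=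
  completePart K d f ⊔ lastPart K f

/-! ### Clusters -/

/-- A `(d-1)`-edge of `I`: a squarefree monomial of degree `d - 1` that divides a generator. -/
def IsEdge {n : ℕ} {K : Type*} [Field K] (I : Ideal (MvPolynomial (Fin n) K)) (d : ℕ)
    (u : Fin n →₀ ℕ) : Prop :=
  IsSquarefreeMonomial u ∧ u.degree + 1 = d ∧ ∃ s ∈ minGens I, u ≤ s

/-- A `j`-cluster: a set of `j` generators of `I` all divided by a same `(d-1)`-edge. -/
def IsCluster {n : ℕ} {K : Type*} [Field K] (I : Ideal (MvPolynomial (Fin n) K)) (d j : ℕ)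
    (A : Finset (Fin n →₀ ℕ)) : Prop :=
  (A : Set (Fin n →₀ ℕ)) ⊆ minGens I ∧ A.card = j ∧ ∃ u, IsEdge I d u ∧ ∀ s ∈ A, u ≤ s

/-- `C_j`: the number of `j`-clusters that are not contained in a `(j+1)`-cluster. -/
def numMaxClusters {n : ℕ} {K : Type*} [Field K] (I : Ideal (MvPolynomial (Fin n) K))
    (d j : ℕ) : ℕ :=
  {A : Finset (Fin n →₀ ℕ) | IsCluster I d j A ∧
    ¬ ∃ B, IsCluster I d (j + 1) B ∧ A ⊆ B}.ncard

/-! ### Minimal graded free resolutions and Betti numbers -/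

/-- A minimal graded free resolution `⋯ → F₁ → F₀ → J → 0` of an ideal `J` of a polynomial ring
`R` with its standard grading. The module `F_i` is `⨁_{b ∈ ι i} R(-deg b)`. A linear map preserves
degrees if and only if it sends each basis element to an element of the same degree; the
coefficient at the basis element `a` then contains only monomials of degree `deg b - deg a`. -/
structure MinimalGradedFreeResolution {σ K : Type*} [Field K]
    (J : Ideal (MvPolynomial σ K)) where
  ι : ℕ → Type
  finite_ι : ∀ i, Finite (ι i)
  deg : ∀ i, ι i → ℤ
  d : ∀ i, (ι (i + 1) →₀ MvPolynomial σ K) →ₗ[MvPolynomial σ K] (ι i →₀ MvPolynomial σ K)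
  ε : (ι 0 →₀ MvPolynomial σ K) →ₗ[MvPolynomial σ K] J
  d_graded : ∀ i (b : ι (i + 1)) (a : ι i), ∀ s ∈ (d i (Finsupp.single b 1) a).support,
    (s.degree : ℤ) + deg i a = deg (i + 1) b
  ε_graded : ∀ b : ι 0, ∀ s ∈ (ε (Finsupp.single b 1) : MvPolynomial σ K).support,
    (s.degree : ℤ) = deg 0 b
  ε_surjective : Function.Surjective ε
  exact_zero : Function.Exact (d 0) ε
  exact_succ : ∀ i, Function.Exact (d (i + 1)) (d i)
  minimal : ∀ i, LinearMap.range (d i) ≤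
    Ideal.span (Set.range (X : σ → MvPolynomial σ K)) •
      (⊤ : Submodule (MvPolynomial σ K) (ι i →₀ MvPolynomial σ K))

namespace MinimalGradedFreeResolution

variable {σ K : Type*} [Field K] {J : Ideal (MvPolynomial σ K)}

/-- `β_{ij}`: the number of summands `R(-j)` of `F_i`. -/
def gradedBetti (F : MinimalGradedFreeResolution J) (i : ℕ) (j : ℤ) : ℕ :=
  Nat.card {b : F.ι i // F.deg i b = j}

/-- `β_i = ∑_j β_{ij}`; the sum has finitely many nonzero terms because `ι i` is finite. -/
def totalBetti (F : MinimalGradedFreeResolution J) (i : ℕ) : ℕ :=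
  ∑ᶠ j : ℤ, F.gradedBetti i j

theorem totalBetti_eq_card (F : MinimalGradedFreeResolution J) (i : ℕ) :
    F.totalBetti i = Nat.card (F.ι i) := by
  classical
  haveI := F.finite_ι i
  haveI := Fintype.ofFinite (F.ι i)
  unfold totalBetti gradedBetti
  rw [finsum_eq_sum_of_support_subset (s := Finset.univ.image (F.deg i))]
  · rw [Nat.card_eq_fintype_card, ← Finset.card_univ,
      Finset.card_eq_sum_card_image (F.deg i) Finset.univ]
    refine Finset.sum_congr rfl fun j _ => ?_
    rw [Nat.card_eq_fintype_card, Fintype.card_subtype]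
  · intro j hj
    rw [Function.mem_support] at hj
    obtain ⟨⟨b, hb⟩⟩ := (Nat.card_ne_zero.mp hj).1
    simp only [Finset.coe_image, Finset.coe_univ, Set.image_univ, Set.mem_range]
    exact ⟨b, hb⟩

end MinimalGradedFreeResolution

end StarLinearization

end

/-!
Put `d = e + 1`. The complete part of `LIN(I)` is generated by the squarefree monomials of degree
`d` in the `x`-variables, and the last part by the monomials `x_u y_j`, where `u` is a `(d-1)`-edge
below `f_j`. Add the generators one at a time, first the `x_A` with `#A = d`, then the `x_u y_j`
edge by edge. The previous generators have an ideal of variables as colon ideal with respect to each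
new monomial: for the `k`-th generator added for the edge `u`, the variables are the `x_l` with
`l ∉ u` and the `k - 1` earlier `y_j` with `x_u ∣ f_j`, which makes `n - d + k` of them. The mapping
cone of a linear resolution with the Koszul complex on `c` variables is again a linear resolution,
with `choose c i` new basis elements in homological degree `i`. A linear resolution is minimal, and
the ranks of a minimal resolution do not depend on its choice, since the comparison maps between two
of them are inverse to each other modulo the ideal of all variables.

Two distinct generators of degree `d` have at most one common `(d-1)`-edge. So for `j ≥ 2` the
`j`-clusters that are not contained in a `(j+1)`-cluster correspond to the edges that divide exactly
`j` generators, which turns the sum over the edges into a sum over the clusters.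
-/

noncomputable section

namespace StarLinearization

section Comparison

variable {R : Type*} [CommRing R]

theorem exists_lift_of_range_le {P M N : Type*} [AddCommGroup P] [Module R P]
    [Module.Projective R P] [AddCommGroup M] [Module R M] [AddCommGroup N] [Module R N]
    (f : M →ₗ[R] N) (g : P →ₗ[R] N) (h : g.range ≤ f.range) : ∃ θ : P →ₗ[R] M, f ∘ₗ θ = g := by
  obtain ⟨θ, hθ⟩ := Module.projective_lifting_property f.rangeRestrict
    (g.codRestrict f.range fun x => h ⟨x, rfl⟩) f.surjective_rangeRestrict
  exact ⟨θ, LinearMap.ext fun x => congrArg Subtype.val (LinearMap.congr_fun hθ x)⟩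

theorem exists_chainMap {F G : ℕ → Type*} [∀ i, AddCommGroup (F i)] [∀ i, Module R (F i)]
    [∀ i, AddCommGroup (G i)] [∀ i, Module R (G i)] [∀ i, Module.Projective R (F (i + 1))]
    (dF : ∀ i, F (i + 1) →ₗ[R] F i) (dG : ∀ i, G (i + 1) →ₗ[R] G i)
    (hF : ∀ i, dF i ∘ₗ dF (i + 1) = 0) (hG : ∀ i, Function.Exact (dG (i + 1)) (dG i))
    (φ₀ : F 0 →ₗ[R] G 0) (h₀ : (φ₀ ∘ₗ dF 0).range ≤ (dG 0).range) :
    ∃ φ : ∀ i, F i →ₗ[R] G i, φ 0 = φ₀ ∧ ∀ i, dG i ∘ₗ φ (i + 1) = φ i ∘ₗ dF i := by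
  have step : ∀ i (φ : F i →ₗ[R] G i), (φ ∘ₗ dF i).range ≤ (dG i).range →
      ∃ φ' : F (i + 1) →ₗ[R] G (i + 1), dG i ∘ₗ φ' = φ ∘ₗ dF i ∧
        (φ' ∘ₗ dF (i + 1)).range ≤ (dG (i + 1)).range := by
    intro i φ hφ
    obtain ⟨φ', hφ'⟩ := exists_lift_of_range_le (dG i) (φ ∘ₗ dF i) hφ
    refine ⟨φ', hφ', ?_⟩
    rw [← (hG i).linearMap_ker_eq, LinearMap.range_le_ker_iff, ← LinearMap.comp_assoc, hφ',
      LinearMap.comp_assoc, hF, LinearMap.comp_zero]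
  choose next hnext hrange using step
  let s : ∀ i, {φ : F i →ₗ[R] G i // (φ ∘ₗ dF i).range ≤ (dG i).range} := fun i =>
    Nat.rec ⟨φ₀, h₀⟩ (fun i φ => ⟨next i φ.1 φ.2, hrange i φ.1 φ.2⟩) i
  exact ⟨fun i => (s i).1, rfl, fun i => hnext i (s i).1 (s i).2⟩

theorem range_comp_le_smul_top (𝔪 : Ideal R) {L M N : Type*} [AddCommGroup L] [Module R L]
    [AddCommGroup M] [Module R M] [AddCommGroup N] [Module R N] (f : M →ₗ[R] N) {g : L →ₗ[R] M}
    (hg : g.range ≤ 𝔪 • ⊤) : (f ∘ₗ g).range ≤ 𝔪 • ⊤ := by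
  rintro _ ⟨x, rfl⟩
  exact Submodule.smul_top_le_comap_smul_top 𝔪 f (hg ⟨x, rfl⟩)

/- Such a `δ` is null-homotopic, `δ (i + 1) = d (i + 1) ∘ h' + h ∘ d i`, and both summands land in
`𝔪 F`. -/
theorem range_le_smul_top_of_lifts_zero (𝔪 : Ideal R) {F : ℕ → Type*} {N : Type*}
    [∀ i, AddCommGroup (F i)] [∀ i, Module R (F i)] [∀ i, Module.Projective R (F i)]
    [AddCommGroup N] [Module R N] {d : ∀ i, F (i + 1) →ₗ[R] F i} {ε : F 0 →ₗ[R] N}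
    (hε : Function.Exact (d 0) ε) (hd : ∀ i, Function.Exact (d (i + 1)) (d i))
    (hmin : ∀ i, (d i).range ≤ 𝔪 • ⊤) (δ : ∀ i, F i →ₗ[R] F i) (hδε : ε ∘ₗ δ 0 = 0)
    (hδ : ∀ i, d i ∘ₗ δ (i + 1) = δ i ∘ₗ d i) (i : ℕ) : (δ i).range ≤ 𝔪 • ⊤ := by
  suffices ∃ (h : F i →ₗ[R] F (i + 1)) (k : F i →ₗ[R] F i),
      δ i = d i ∘ₗ h + k ∧ k ∘ₗ d i = 0 ∧ k.range ≤ 𝔪 • ⊤ by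
    obtain ⟨h, k, hhk, -, hk⟩ := this
    rintro _ ⟨x, rfl⟩
    rw [hhk]
    exact add_mem (hmin i ⟨h x, rfl⟩) (hk ⟨x, rfl⟩)
  induction i with
  | zero =>
    obtain ⟨h, hh⟩ := exists_lift_of_range_le (d 0) (δ 0) (by
      rwa [← hε.linearMap_ker_eq, LinearMap.range_le_ker_iff])
    exact ⟨h, 0, by rw [hh, add_zero], LinearMap.zero_comp _, by simp⟩
  | succ i ih =>
    obtain ⟨h, k, hhk, hkd, -⟩ := ih
    obtain ⟨h', hh'⟩ := exists_lift_of_range_le (d (i + 1)) (δ (i + 1) - h ∘ₗ d i) (by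
      rw [← (hd i).linearMap_ker_eq, LinearMap.range_le_ker_iff, LinearMap.comp_sub, hδ, hhk,
        LinearMap.add_comp, hkd, add_zero, LinearMap.comp_assoc, sub_self])
    refine ⟨h', h ∘ₗ d i, by rw [hh', sub_add_cancel], ?_, range_comp_le_smul_top 𝔪 h (hmin i)⟩
    rw [LinearMap.comp_assoc, (hd i).linearMap_comp_eq_zero, LinearMap.comp_zero]

theorem apply_mem_of_mem_smul_top {𝔪 : Ideal R} {ι : Type*} {x : ι →₀ R}
    (hx : x ∈ 𝔪 • (⊤ : Submodule R (ι →₀ R))) (a : ι) : x a ∈ 𝔪 := by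
  simpa using Submodule.smul_top_le_comap_smul_top 𝔪 (Finsupp.lapply (R := R) a) hx

/- Modulo `𝔪`, the matrices of `ψ` and `φ` have product `1`; compare ranks. -/
theorem card_le_card_of_range_comp_sub_id_le {𝔪 : Ideal R} (h𝔪 : 𝔪 ≠ ⊤) {ι κ : Type*} [Finite ι]
    [Finite κ] (φ : (ι →₀ R) →ₗ[R] (κ →₀ R)) (ψ : (κ →₀ R) →ₗ[R] (ι →₀ R))
    (h : (ψ ∘ₗ φ - LinearMap.id).range ≤ 𝔪 • ⊤) : Nat.card ι ≤ Nat.card κ := by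
  classical
  have := Fintype.ofFinite ι
  have := Fintype.ofFinite κ
  have := Ideal.Quotient.nontrivial_iff.2 h𝔪
  let A := LinearMap.toMatrix Finsupp.basisSingleOne Finsupp.basisSingleOne φ
  let B := LinearMap.toMatrix Finsupp.basisSingleOne Finsupp.basisSingleOne ψ
  have hBA : B.map (Ideal.Quotient.mk 𝔪) * A.map (Ideal.Quotient.mk 𝔪) = 1 := by
    rw [← Matrix.map_mul, ← LinearMap.toMatrix_comp]
    ext a b
    have hab := apply_mem_of_mem_smul_top (h ⟨Finsupp.single b 1, rfl⟩) a
    rw [← Ideal.Quotient.eq_zero_iff_mem] at hab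
    simpa [LinearMap.toMatrix_apply, sub_eq_zero, Matrix.one_apply, Finsupp.single_apply,
      eq_comm (a := a), apply_ite (Ideal.Quotient.mk 𝔪)] using hab
  rw [Nat.card_eq_fintype_card, Nat.card_eq_fintype_card, ← Matrix.rank_one (R := R ⧸ 𝔪), ← hBA]
  exact (Matrix.rank_mul_le_right _ _).trans (Matrix.rank_le_card_height _)

theorem span_range_X_ne_top {σ : Type*} [Nontrivial R] :
    Ideal.span (Set.range (X : σ → MvPolynomial σ R)) ≠ ⊤ := by
  have : Ideal.span (Set.range (X : σ → MvPolynomial σ R)) ≤ RingHom.ker constantCoeff :=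
    Ideal.span_le.2 (by rintro _ ⟨k, rfl⟩; exact constantCoeff_X _ k)
  exact ne_top_of_le_ne_top (RingHom.ker_ne_top _) this

end Comparison

namespace MinimalGradedFreeResolution

variable {σ K : Type*} [Field K] {J : Ideal (MvPolynomial σ K)}

theorem exists_comparison (F G : MinimalGradedFreeResolution J) :
    ∃ φ : ∀ i, (F.ι i →₀ MvPolynomial σ K) →ₗ[MvPolynomial σ K] (G.ι i →₀ MvPolynomial σ K),
      G.ε ∘ₗ φ 0 = F.ε ∧ ∀ i, G.d i ∘ₗ φ (i + 1) = φ i ∘ₗ F.d i := by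
  obtain ⟨φ₀, h₀⟩ := exists_lift_of_range_le G.ε F.ε
    (le_top.trans_eq (LinearMap.range_eq_top.2 G.ε_surjective).symm)
  obtain ⟨φ, rfl, hφ⟩ := exists_chainMap (F := fun i => F.ι i →₀ MvPolynomial σ K)
    (G := fun i => G.ι i →₀ MvPolynomial σ K) F.d G.d
    (fun i => (F.exact_succ i).linearMap_comp_eq_zero) G.exact_succ φ₀ (by
      rw [← G.exact_zero.linearMap_ker_eq, LinearMap.range_le_ker_iff, ← LinearMap.comp_assoc, h₀,
        F.exact_zero.linearMap_comp_eq_zero])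
  exact ⟨φ, h₀, hφ⟩

theorem card_le_card (F G : MinimalGradedFreeResolution J) (i : ℕ) :
    Nat.card (F.ι i) ≤ Nat.card (G.ι i) := by
  have := F.finite_ι i
  have := G.finite_ι i
  obtain ⟨φ, hφε, hφ⟩ := F.exists_comparison G
  obtain ⟨ψ, hψε, hψ⟩ := G.exists_comparison F
  refine card_le_card_of_range_comp_sub_id_le span_range_X_ne_top (φ i) (ψ i) ?_
  refine range_le_smul_top_of_lifts_zero _ F.exact_zero F.exact_succ F.minimal
    (fun i => ψ i ∘ₗ φ i - LinearMap.id) ?_ (fun i => ?_) i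
  · rw [LinearMap.comp_sub, ← LinearMap.comp_assoc, hψε, hφε, LinearMap.comp_id]
    exact sub_self F.ε
  · rw [LinearMap.comp_sub, LinearMap.sub_comp, ← LinearMap.comp_assoc, hψ, LinearMap.comp_assoc,
      hφ, LinearMap.comp_assoc, LinearMap.comp_id, LinearMap.id_comp]

theorem totalBetti_eq_totalBetti (F G : MinimalGradedFreeResolution J) (i : ℕ) :
    F.totalBetti i = G.totalBetti i := by
  rw [totalBetti_eq_card, totalBetti_eq_card]
  exact le_antisymm (F.card_le_card G i) (G.card_le_card F i)

end MinimalGradedFreeResolution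

section LinearResolution

variable {σ R : Type*} [CommRing R]

theorem homogeneousComponent_mul_of_isHomogeneous {e : ℕ} (k : ℕ) (p : MvPolynomial σ R)
    {t : MvPolynomial σ R} (ht : t.IsHomogeneous e) :
    homogeneousComponent (k + e) (p * t) = homogeneousComponent k p * t := by
  let _ : GradedAlgebra (homogeneousSubmodule σ R) := gradedAlgebra
  have h := DirectSum.coe_decompose_mul_of_right_mem_of_le
    (homogeneousSubmodule σ R) (a := p) (n := k + e) ht (Nat.le_add_left e k)
  rw [Nat.add_sub_cancel] at h
  exact (decomposition.decompose'_apply _ _).symm.trans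
    (h.trans (congrArg (· * t) (decomposition.decompose'_apply _ _)))

theorem matrix_mul_map_homogeneousComponent {l m n : Type*} [Fintype m] {e : ℕ} (k : ℕ)
    {A : Matrix l m (MvPolynomial σ R)} (hA : ∀ a b, (A a b).IsHomogeneous e)
    (B : Matrix m n (MvPolynomial σ R)) :
    A * B.map (homogeneousComponent k) = (A * B).map (homogeneousComponent (e + k)) := by
  ext1 a c
  simp only [Matrix.mul_apply, Matrix.map_apply, map_sum, mul_comm (A a _), add_comm e,
    homogeneousComponent_mul_of_isHomogeneous k _ (hA a _)]

theorem matrix_map_homogeneousComponent_mul {l m n : Type*} [Fintype m] {e : ℕ} (k : ℕ)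
    (A : Matrix l m (MvPolynomial σ R)) {B : Matrix m n (MvPolynomial σ R)}
    (hB : ∀ b c, (B b c).IsHomogeneous e) :
    A.map (homogeneousComponent k) * B = (A * B).map (homogeneousComponent (k + e)) := by
  ext1 a c
  simp only [Matrix.mul_apply, Matrix.map_apply, map_sum,
    homogeneousComponent_mul_of_isHomogeneous k _ (hB _ c)]

/-- A linear free resolution `⋯ → F₂ → F₁ → F₀ → S/J → 0` over `S = R[σ]` with `F₀ = S`, where `J`
is generated in degree `q`. The modules are `F i = ι i → S`, with basis elements of degree `0` for
`i = 0` and `q + i - 1` for `i > 0`, and the differentials are matrices. -/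
structure LinearResolution (J : Ideal (MvPolynomial σ R)) (q : ℕ) where
  ι : ℕ → Type
  [fintype : ∀ i, Fintype (ι i)]
  [unique : Unique (ι 0)]
  d : ∀ i, Matrix (ι i) (ι (i + 1)) (MvPolynomial σ R)
  isHomogeneous : ∀ i a b, (d i a b).IsHomogeneous (if i = 0 then q else 1)
  span_range : Ideal.span (Set.range (d 0 default)) = J
  exact : ∀ i, Function.Exact (d (i + 1)).mulVecLin (d i).mulVecLin

attribute [instance] LinearResolution.fintype LinearResolution.unique

/-- `J` has a linear resolution whose ranks are given by `b`. The indexing is that of a resolution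
of `J`: `b i` is the rank of `F (i + 1)` in the resolution of `S/J`. -/
def HasLinearResolution (J : Ideal (MvPolynomial σ R)) (q : ℕ) (b : ℕ → ℕ) : Prop :=
  ∃ F : LinearResolution J q, ∀ i, Fintype.card (F.ι (i + 1)) = b i

theorem hasLinearResolution_bot (q : ℕ) :
    HasLinearResolution (⊥ : Ideal (MvPolynomial σ R)) q fun _ => 0 := by
  have (i : ℕ) : IsEmpty (Fin (if i + 1 = 0 then 1 else 0)) := inferInstanceAs (IsEmpty (Fin 0))
  exact ⟨{
    ι := fun i => Fin (if i = 0 then 1 else 0)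
    unique := inferInstanceAs (Unique (Fin 1))
    d := fun _ _ => 0
    isHomogeneous := fun i _ b => isEmptyElim b
    span_range := by rw [Set.range_eq_empty, Ideal.span_empty]
    exact := fun i y =>
      ⟨fun _ => ⟨0, Subsingleton.elim _ _⟩, fun _ => by rw [Subsingleton.elim y 0, map_zero]⟩ },
    fun i => by simp⟩

namespace LinearResolution

variable {J : Ideal (MvPolynomial σ R)} {q : ℕ}

theorem mem_range_zero_iff (F : LinearResolution J q) (y : F.ι 0 → MvPolynomial σ R) :
    y ∈ (F.d 0).mulVecLin.range ↔ y default ∈ J := by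
  have h : y default ∈ J ↔ y default ∈ Ideal.span (Set.range (F.d 0 default)) := by
    rw [F.span_range]
  simp only [h, Ideal.mem_span_range_iff_exists_fun, LinearMap.mem_range, funext_iff,
    Unique.forall_iff, Matrix.mulVecLin_apply, Matrix.mulVec, dotProduct, mul_comm]

variable {g : MvPolynomial σ R}

/- The homogeneous components of the right degree of an arbitrary lift still form a lift. -/
theorem exists_lift_mul (F : LinearResolution J q) (G : LinearResolution (J.colon {g}) 1)
    (hg : g.IsHomogeneous q) :
    ∃ θ : ∀ i, Matrix (F.ι i) (G.ι i) (MvPolynomial σ R), (∀ a b, θ 0 a b = g) ∧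
      (∀ i a b, (θ i a b).IsHomogeneous (if i = 0 then q else 1)) ∧
      ∀ i, F.d i * θ (i + 1) = θ i * G.d i := by
  classical
  obtain ⟨φ, hφ₀, hφ⟩ := exists_chainMap (F := fun i => G.ι i → MvPolynomial σ R)
    (G := fun i => F.ι i → MvPolynomial σ R) (fun i => (G.d i).mulVecLin)
    (fun i => (F.d i).mulVecLin) (fun i => (G.exact i).linearMap_comp_eq_zero) F.exact
    (Matrix.of fun _ _ => g).mulVecLin (by
      rintro _ ⟨x, rfl⟩
      have := (G.mem_range_zero_iff _).1 ⟨x, rfl⟩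
      rw [Submodule.mem_colon_singleton, smul_eq_mul, mul_comm] at this
      rw [F.mem_range_zero_iff]
      simpa [Matrix.mulVec, dotProduct] using this)
  let A : ∀ i, Matrix (F.ι i) (G.ι i) (MvPolynomial σ R) := fun i => (φ i).toMatrix'
  have hA : ∀ i, F.d i * A (i + 1) = A i * G.d i := fun i => by
    simpa only [LinearMap.toMatrix'_comp, ← Matrix.toLin'_apply', LinearMap.toMatrix'_toLin'] using
      congrArg LinearMap.toMatrix' (hφ i)
  refine ⟨fun i => (A i).map (homogeneousComponent (if i = 0 then q else 1)), fun a b => ?_,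
    fun i a b => homogeneousComponent_isHomogeneous _ _, fun i => ?_⟩
  · simp [A, hφ₀, homogeneousComponent_eq_self hg]
  · have hG : ∀ a b, (G.d i a b).IsHomogeneous 1 := by simpa using G.isHomogeneous i
    rw [matrix_map_homogeneousComponent_mul _ _ hG]
    simp only [i.succ_ne_zero, if_false]
    rw [matrix_mul_map_homogeneousComponent 1 (F.isHomogeneous i), hA]

end LinearResolution

end LinearResolution

section MappingCone

theorem mapping_cone_exact {R : Type*} [Ring R] {M₂ M₁ M₀ N₂ N₁ : Type*}
    [AddCommGroup M₂] [Module R M₂] [AddCommGroup M₁] [Module R M₁] [AddCommGroup M₀] [Module R M₀]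
    [AddCommGroup N₂] [Module R N₂] [AddCommGroup N₁] [Module R N₁]
    {α₁ : M₂ →ₗ[R] M₁} {α₀ : M₁ →ₗ[R] M₀} {β : N₂ →ₗ[R] N₁} {θ₁ : N₂ →ₗ[R] M₁} {θ₀ : N₁ →ₗ[R] M₀}
    {P : N₁ → Prop} (hα : Function.Exact α₁ α₀) (hθ : α₀ ∘ₗ θ₁ = θ₀ ∘ₗ β)
    (hβ : ∀ y, P y ∧ θ₀ y ∈ α₀.range ↔ y ∈ β.range) (x : M₁) (y : N₁) :
    α₀ x + θ₀ y = 0 ∧ P y ↔ ∃ v w, α₁ v + θ₁ w = x ∧ -β w = y := by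
  have hθ' (w : N₂) : α₀ (θ₁ w) = θ₀ (β w) := LinearMap.congr_fun hθ w
  constructor
  · rintro ⟨hxy, hy⟩
    obtain ⟨w, rfl⟩ := (hβ y).1 ⟨hy, -x, by rw [map_neg, neg_eq_of_add_eq_zero_right hxy]⟩
    obtain ⟨v, hv⟩ := (hα (x + θ₁ w)).1 (by rw [map_add, hθ', hxy])
    exact ⟨v, -w, by rw [hv, map_neg, add_neg_cancel_right], by rw [map_neg, neg_neg]⟩
  · rintro ⟨v, w, rfl, rfl⟩
    refine ⟨?_, ((hβ (-β w)).2 ⟨-w, map_neg β w⟩).1⟩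
    rw [map_add, hα.apply_apply_eq_zero, zero_add, hθ', map_neg, add_neg_cancel]

theorem mem_range_fromBlocks_iff {R l m n o : Type*} [CommRing R] [Fintype l] [Fintype m]
    (A : Matrix n l R) (θ : Matrix n m R) (B : Matrix o m R) (z : n ⊕ o → R) :
    z ∈ Set.range (Matrix.fromBlocks A θ 0 (-B)).mulVecLin ↔
      ∃ v w, A.mulVecLin v + θ.mulVecLin w = z ∘ Sum.inl ∧ -B.mulVecLin w = z ∘ Sum.inr := by
  rw [Set.mem_range, (Equiv.sumArrowEquivProdArrow l m R).exists_congr_left, Prod.exists]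
  refine exists₂_congr fun v w => ?_
  rw [← Sum.elim_comp_inl_inr z, Matrix.mulVecLin_apply, Matrix.fromBlocks_mulVec,
    Sum.elim_eq_iff]
  simp [Equiv.sumArrowEquivProdArrow, Matrix.neg_mulVec]

namespace LinearResolution

variable {σ R : Type*} [CommRing R] {J : Ideal (MvPolynomial σ R)} {q : ℕ} {g : MvPolynomial σ R}

theorem mem_range_zero_iff_of_colon (F : LinearResolution J q)
    (G : LinearResolution (J.colon {g}) 1) {θ : Matrix (F.ι 0) (G.ι 0) (MvPolynomial σ R)}
    (hθ : ∀ a b, θ a b = g) (y : G.ι 0 → MvPolynomial σ R) :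
    θ.mulVecLin y ∈ (F.d 0).mulVecLin.range ↔ y ∈ (G.d 0).mulVecLin.range := by
  rw [F.mem_range_zero_iff, G.mem_range_zero_iff, Submodule.mem_colon_singleton, smul_eq_mul,
    mul_comm]
  simp [Matrix.mulVec, dotProduct, hθ]

theorem span_range_fromCols (F : LinearResolution J q) {κ : Type*} [Nonempty κ]
    {θ : Matrix (F.ι 0) κ (MvPolynomial σ R)} (hθ : ∀ a b, θ a b = g) :
    Ideal.span (Set.range (Matrix.fromCols (F.d 0) θ default)) = J ⊔ Ideal.span {g} := by
  have h : Set.range (Matrix.fromCols (F.d 0) θ default) =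
      Set.range (F.d 0 default) ∪ {g} := by
    rw [← Set.range_const (ι := κ) (c := g), ← Set.Sum.elim_range]
    exact congrArg Set.range (funext (Sum.rec (fun _ => rfl) (hθ default)))
  rw [h, Ideal.span_union, F.span_range]

variable (F : LinearResolution J q) (G : LinearResolution (J.colon {g}) 1)
  {θ : ∀ i, Matrix (F.ι i) (G.ι i) (MvPolynomial σ R)}

theorem exact_fromBlocks_fromCols (hθ : ∀ a b, θ 0 a b = g)
    (hcomm : F.d 0 * θ 1 = θ 0 * G.d 0) :
    Function.Exact (Matrix.fromBlocks (F.d 1) (θ 1) 0 (-G.d 0)).mulVecLin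
      (Matrix.fromCols (F.d 0) (θ 0)).mulVecLin := by
  intro z
  rw [mem_range_fromBlocks_iff, ← mapping_cone_exact (P := fun _ => True) (F.exact 0)
    (θ₀ := (θ 0).mulVecLin) (by rw [← Matrix.mulVecLin_mul, hcomm, Matrix.mulVecLin_mul])
    (by simpa only [true_and] using F.mem_range_zero_iff_of_colon G hθ)]
  simp [Matrix.fromCols_mulVec]

theorem exact_fromBlocks_fromBlocks (i : ℕ)
    (hcomm : F.d (i + 1) * θ (i + 2) = θ (i + 1) * G.d (i + 1)) :
    Function.Exact (Matrix.fromBlocks (F.d (i + 2)) (θ (i + 2)) 0 (-G.d (i + 1))).mulVecLin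
      (Matrix.fromBlocks (F.d (i + 1)) (θ (i + 1)) 0 (-G.d i)).mulVecLin := by
  have hcomm' : (F.d (i + 1)).mulVecLin ∘ₗ (θ (i + 2)).mulVecLin =
      (θ (i + 1)).mulVecLin ∘ₗ (G.d (i + 1)).mulVecLin := by
    rw [← Matrix.mulVecLin_mul, hcomm, Matrix.mulVecLin_mul]
  have hβ (y : G.ι (i + 1) → MvPolynomial σ R) : (G.d i).mulVecLin y = 0 ∧
      (θ (i + 1)).mulVecLin y ∈ (F.d (i + 1)).mulVecLin.range ↔
        y ∈ (G.d (i + 1)).mulVecLin.range := by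
    refine ⟨fun h => (G.exact i y).1 h.1, ?_⟩
    rintro ⟨w, rfl⟩
    exact ⟨(G.exact i).apply_apply_eq_zero w, (θ (i + 2)).mulVecLin w, LinearMap.congr_fun hcomm' w⟩
  intro z
  rw [mem_range_fromBlocks_iff, ← mapping_cone_exact (F.exact (i + 1)) hcomm' hβ]
  rw [Matrix.mulVecLin_apply, Matrix.fromBlocks_mulVec, ← Sum.elim_zero_zero, Sum.elim_eq_iff]
  simp [Matrix.neg_mulVec]

end LinearResolution

open LinearResolution in
theorem HasLinearResolution.sup_span_singleton {σ R : Type*} [CommRing R]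
    {J : Ideal (MvPolynomial σ R)} {q : ℕ} {b c : ℕ → ℕ} {g : MvPolynomial σ R}
    (hJ : HasLinearResolution J q b) (hg : g.IsHomogeneous q)
    (hc : HasLinearResolution (J.colon {g}) 1 fun i => c (i + 1)) (hc₀ : c 0 = 1) :
    HasLinearResolution (J ⊔ Ideal.span {g}) q fun i => b i + c i := by
  obtain ⟨F, hF⟩ := hJ
  obtain ⟨G, hG⟩ := hc
  obtain ⟨θ, hθ₀, hθ, hcomm⟩ := F.exists_lift_mul G hg
  refine ⟨{
    ι := fun | 0 => F.ι 0 | i + 1 => F.ι (i + 1) ⊕ G.ι i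
    fintype := fun | 0 => F.fintype 0 | i + 1 => inferInstanceAs (Fintype (F.ι (i + 1) ⊕ G.ι i))
    unique := F.unique
    d := fun
      | 0 => Matrix.fromCols (F.d 0) (θ 0)
      | i + 1 => Matrix.fromBlocks (F.d (i + 1)) (θ (i + 1)) 0 (-G.d i)
    isHomogeneous := fun
      | 0, a, .inl b => F.isHomogeneous 0 a b
      | 0, a, .inr b => hθ 0 a b
      | i + 1, .inl a, .inl b => F.isHomogeneous (i + 1) a b
      | i + 1, .inl a, .inr b => hθ (i + 1) a b
      | i + 1, .inr _, .inl _ => isHomogeneous_zero _ _ _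
      | i + 1, .inr a, .inr b =>
        (by simpa using G.isHomogeneous i a b : (G.d i a b).IsHomogeneous 1).neg
    span_range := F.span_range_fromCols hθ₀
    exact := fun
      | 0 => F.exact_fromBlocks_fromCols G hθ₀ (hcomm 0)
      | i + 1 => F.exact_fromBlocks_fromBlocks G i (hcomm (i + 1)) }, fun i => ?_⟩
  have hGc : Fintype.card (G.ι i) = c i := by
    cases i with
    | zero => rw [hc₀, Fintype.card_unique]
    | succ i => exact hG i
  exact Fintype.card_sum.trans (congrArg₂ (· + ·) (hF i) hGc)

end MappingCone

section Betti

/-- Multiplication by a matrix, as a map between the free modules of finitely supported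
functions. -/
def mulVecFinsupp {R m n : Type*} [CommRing R] [Fintype m] [Fintype n] (A : Matrix m n R) :
    (n →₀ R) →ₗ[R] (m →₀ R) :=
  (Finsupp.linearEquivFunOnFinite R R m).symm ∘ₗ A.mulVecLin ∘ₗ
    (Finsupp.linearEquivFunOnFinite R R n).toLinearMap

section mulVecFinsupp

variable {R l m n : Type*} [CommRing R] [Fintype l] [Fintype m] [Fintype n]

theorem mulVecFinsupp_single_one (A : Matrix m n R) (b : n) (a : m) :
    mulVecFinsupp A (Finsupp.single b 1) a = A a b := by
  classical
  simp [mulVecFinsupp, Finsupp.linearEquivFunOnFinite_single]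

theorem exact_mulVecFinsupp {A : Matrix m n R} {B : Matrix l m R}
    (h : Function.Exact A.mulVecLin B.mulVecLin) :
    Function.Exact (mulVecFinsupp A) (mulVecFinsupp B) :=
  (Function.Exact.iff_of_ladder_linearEquiv (e₁ := Finsupp.linearEquivFunOnFinite R R n)
    (e₂ := Finsupp.linearEquivFunOnFinite R R m) (e₃ := Finsupp.linearEquivFunOnFinite R R l)
    rfl rfl).1 h

theorem range_mulVecFinsupp_le {𝔪 : Ideal R} {A : Matrix m n R} (hA : ∀ a b, A a b ∈ 𝔪) :
    (mulVecFinsupp A).range ≤ 𝔪 • ⊤ := by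
  rintro _ ⟨x, rfl⟩
  rw [← Finsupp.univ_sum_single (mulVecFinsupp A x)]
  refine Submodule.sum_mem _ fun a _ => ?_
  rw [← mul_one (mulVecFinsupp A x a), ← smul_eq_mul, ← Finsupp.smul_single]
  exact Submodule.smul_mem_smul
    (Ideal.sum_mem _ fun b _ => Ideal.mul_mem_right _ _ (hA a b)) trivial

end mulVecFinsupp

variable {σ K : Type*} [Field K] {J : Ideal (MvPolynomial σ K)} {q : ℕ}

/-- The minimal graded free resolution of `J` obtained from a linear resolution of `S/J` by
deleting `S/J` and `F₀`. -/
def LinearResolution.toMinimal (F : LinearResolution J q) : MinimalGradedFreeResolution J where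
  ι i := F.ι (i + 1)
  finite_ι i := inferInstance
  deg i _ := q + i
  d i := mulVecFinsupp (F.d (i + 1))
  ε := (Finsupp.linearCombination _ (F.d 0 default)).codRestrict J fun x =>
    F.span_range.le (by
      rw [Ideal.span, ← Finsupp.range_linearCombination]
      exact ⟨x, rfl⟩)
  d_graded i b a s hs := by
    rw [mulVecFinsupp_single_one, mem_support_iff] at hs
    have h : s.degree = 1 := by
      contrapose! hs
      exact (F.isHomogeneous (i + 1) a b).coeff_eq_zero hs
    rw [h]
    push_cast
    ring
  ε_graded b s hs := by
    have h : s.degree = q := by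
      contrapose! hs
      simpa using (F.isHomogeneous 0 default b).coeff_eq_zero hs
    rw [h]
    simp
  ε_surjective := by
    rintro ⟨y, hy⟩
    rw [← F.span_range, Ideal.span, ← Finsupp.range_linearCombination] at hy
    obtain ⟨x, rfl⟩ := hy
    exact ⟨x, rfl⟩
  exact_zero x := by
    have h : Finsupp.linearCombination _ (F.d 0 default) =
        Finsupp.lapply default ∘ₗ mulVecFinsupp (F.d 0) :=
      Finsupp.lhom_ext' fun b => LinearMap.ext_ring (by simp [mulVecFinsupp_single_one])
    rw [← exact_mulVecFinsupp (F.exact 0) x, Subtype.ext_iff, DFunLike.ext_iff (F := _ →₀ _),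
      Unique.forall_iff]
    exact Eq.congr_left (LinearMap.congr_fun h x)
  exact_succ i := exact_mulVecFinsupp (F.exact (i + 1))
  minimal i := range_mulVecFinsupp_le fun a b => by
    have h := (mem_pow_idealOfVars_iff' 1 (F.d (i + 1) a b)).2 fun s hs =>
      (F.isHomogeneous (i + 1) a b).coeff_eq_zero hs.ne
    rwa [pow_one] at h

theorem HasLinearResolution.nonempty_and_totalBetti_eq {b : ℕ → ℕ}
    (h : HasLinearResolution J q b) : Nonempty (MinimalGradedFreeResolution J) ∧
      ∀ (F : MinimalGradedFreeResolution J) (i : ℕ), F.totalBetti i = b i := by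
  obtain ⟨G, hG⟩ := h
  refine ⟨⟨G.toMinimal⟩, fun F i => ?_⟩
  rw [F.totalBetti_eq_totalBetti G.toMinimal, MinimalGradedFreeResolution.totalBetti_eq_card,
    ← hG, ← Nat.card_eq_fintype_card]
  rfl

end Betti

section SquarefreeIdeal

variable {σ R : Type*} [CommRing R]

theorem colon_span_monomial_eq_span_X {A : Set (σ →₀ ℕ)} {s : σ →₀ ℕ} {V : Set σ}
    (hA : ∀ t ∈ A, ∃ k ∈ V, s k < t k)
    (hV : ∀ k ∈ V, ∃ t ∈ A, t ≤ s + Finsupp.single k 1) :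
    (Ideal.span ((fun t => monomial t (1 : R)) '' A)).colon {monomial s 1} =
      Ideal.span (X '' V) := by
  classical
  ext r
  simp only [Submodule.mem_colon_singleton, smul_eq_mul, mem_ideal_span_monomial_image,
    mem_ideal_span_X_image]
  constructor
  · intro h m hm
    obtain ⟨t, ht, hle⟩ := h (m + s) (by simpa using hm)
    obtain ⟨k, hk, hlt⟩ := hA t ht
    have := hle k
    rw [Finsupp.add_apply] at this
    exact ⟨k, hk, by omega⟩
  · intro h m hm
    rw [mem_support_iff, coeff_mul_monomial', mul_one, ite_ne_right_iff] at hm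
    obtain ⟨hsm, hm⟩ := hm
    obtain ⟨k, hk, hne⟩ := h (m - s) (mem_support_iff.2 hm)
    obtain ⟨t, ht, hle⟩ := hV k hk
    refine ⟨t, ht, hle.trans ?_⟩
    rw [← add_tsub_cancel_of_le hsm]
    gcongr
    simpa [Nat.one_le_iff_ne_zero] using hne

theorem hasLinearResolution_span_X (V : Finset σ) :
    HasLinearResolution (Ideal.span (X '' V) : Ideal (MvPolynomial σ R)) 1
      fun i => V.card.choose (i + 1) := by
  classical
  induction V using Finset.induction_on with
  | empty => simpa using hasLinearResolution_bot (R := R) (σ := σ) 1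
  | insert k V hk ih =>
    have hcolon : (Ideal.span (X '' V) : Ideal (MvPolynomial σ R)).colon {X k} =
        Ideal.span (X '' V) := by
      have h := colon_span_monomial_eq_span_X (R := R) (A := (Finsupp.single · 1) '' V)
        (s := Finsupp.single k 1) (V := V) (by
          rintro _ ⟨l, hl, rfl⟩
          have hkl : k ≠ l := fun h => hk (h ▸ hl)
          exact ⟨l, hl, by simp [hkl]⟩)
        fun l hl => ⟨_, ⟨l, hl, rfl⟩, le_add_self⟩
      rwa [Set.image_image] at h
    have h := ih.sup_span_singleton (c := V.card.choose) (isHomogeneous_X R k)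
      (by rwa [hcolon]) (Nat.choose_zero_right _)
    rw [Finset.coe_insert, Set.image_insert_eq, Ideal.span_insert, sup_comm]
    simpa only [Finset.card_insert_of_notMem hk, Nat.choose_succ_succ', add_comm] using h

/-- The exponent vector of the squarefree monomial with support `s`. -/
def squarefreeExponent (s : Finset σ) : σ →₀ ℕ := ∑ k ∈ s, Finsupp.single k 1

theorem squarefreeExponent_apply [DecidableEq σ] (s : Finset σ) (k : σ) :
    squarefreeExponent s k = if k ∈ s then 1 else 0 := by
  simp [squarefreeExponent, Finsupp.finsetSum_apply, Finsupp.single_apply]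

theorem support_squarefreeExponent (s : Finset σ) : (squarefreeExponent s).support = s := by
  classical
  ext k
  simp [squarefreeExponent_apply]

theorem squarefreeExponent_injective :
    Function.Injective (squarefreeExponent : Finset σ → σ →₀ ℕ) := fun s t h => by
  rw [← support_squarefreeExponent s, h, support_squarefreeExponent]

theorem degree_squarefreeExponent (s : Finset σ) : (squarefreeExponent s).degree = s.card := by
  simp [squarefreeExponent]

theorem squarefreeExponent_insert [DecidableEq σ] {s : Finset σ} {k : σ} (hk : k ∉ s) :
    squarefreeExponent (insert k s) = squarefreeExponent s + Finsupp.single k 1 := by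
  rw [squarefreeExponent, Finset.sum_insert hk, add_comm, squarefreeExponent]

theorem squarefreeExponent_map {τ : Type*} (φ : σ ↪ τ) (s : Finset σ) :
    squarefreeExponent (s.map φ) = (squarefreeExponent s).mapDomain φ := by
  simp [squarefreeExponent, Finsupp.mapDomain_finsetSum]

theorem isSquarefreeMonomial_squarefreeExponent (s : Finset σ) :
    IsSquarefreeMonomial (squarefreeExponent s) := by
  classical
  intro k
  rw [squarefreeExponent_apply]
  split_ifs <;> simp

theorem IsSquarefreeMonomial.exists_eq_squarefreeExponent {s : σ →₀ ℕ}
    (hs : IsSquarefreeMonomial s) : ∃ t, s = squarefreeExponent t := by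
  classical
  refine ⟨s.support, Finsupp.ext fun k => ?_⟩
  have := hs k
  rw [squarefreeExponent_apply]
  split_ifs with hk <;> rw [Finsupp.mem_support_iff] at hk <;> omega

theorem squarefreeExponent_le_iff {s : Finset σ} {t : σ →₀ ℕ} :
    squarefreeExponent s ≤ t ↔ s ⊆ t.support := by
  classical
  refine forall_congr' fun k => ?_
  rw [squarefreeExponent_apply, Finsupp.mem_support_iff]
  split_ifs with hk <;> simp [hk, Nat.one_le_iff_ne_zero]

theorem squarefreeExponent_le_squarefreeExponent_iff {s t : Finset σ} :
    squarefreeExponent s ≤ squarefreeExponent t ↔ s ⊆ t := by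
  rw [squarefreeExponent_le_iff, support_squarefreeExponent]

variable (R) in
/-- The ideal generated by the squarefree monomials whose supports are the members of `𝒜`. -/
def squarefreeIdeal (𝒜 : Finset (Finset σ)) : Ideal (MvPolynomial σ R) :=
  Ideal.span ((fun s => monomial (squarefreeExponent s) 1) '' 𝒜)

theorem squarefreeIdeal_union [DecidableEq σ] (𝒜 ℬ : Finset (Finset σ)) :
    squarefreeIdeal R (𝒜 ∪ ℬ) = squarefreeIdeal R 𝒜 ⊔ squarefreeIdeal R ℬ := by
  rw [squarefreeIdeal, Finset.coe_union, Set.image_union, Ideal.span_union]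
  rfl

theorem colon_squarefreeIdeal_eq_span_X [DecidableEq σ] {𝒜 : Finset (Finset σ)}
    {t V : Finset σ} (hA : ∀ s ∈ 𝒜, ∃ k ∈ V, k ∈ s \ t) (hV : ∀ k ∈ V, ∃ s ∈ 𝒜, s ⊆ insert k t) :
    (squarefreeIdeal R 𝒜).colon {monomial (squarefreeExponent t) 1} =
      Ideal.span (X '' V) := by
  have h := colon_span_monomial_eq_span_X (R := R) (A := squarefreeExponent '' 𝒜)
    (s := squarefreeExponent t) (V := V) (by
      rintro _ ⟨s, hs, rfl⟩
      obtain ⟨k, hk, hks⟩ := hA s hs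
      rw [Finset.mem_sdiff] at hks
      exact ⟨k, hk, by simp [squarefreeExponent_apply, hks]⟩)
    (by
      intro k hk
      obtain ⟨s, hs, hst⟩ := hV k hk
      refine ⟨_, ⟨s, hs, rfl⟩, squarefreeExponent_le_iff.2 (hst.trans fun l hl => ?_)⟩
      rcases Finset.mem_insert.1 hl with rfl | hl <;> simp [squarefreeExponent_apply, *])
  rwa [Set.image_image] at h

theorem exists_mem_sdiff_of_mem_powersetCard_union [DecidableEq σ] {s u t : Finset σ}
    {U : Finset (Finset σ)} {Y : Finset σ → Finset σ} (hU : U ⊆ s.powersetCard u.card) (hu : u ∉ U)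
    (ht : t ∈ s.powersetCard (u.card + 1) ∪ U.biUnion fun v => (Y v).image (insert · v)) :
    ∃ k ∈ s \ u, k ∈ t \ u := by
  obtain ⟨v, hvs, hvt, hvu⟩ : ∃ v ⊆ s, v ⊆ t ∧ ¬ v ⊆ u := by
    rcases Finset.mem_union.1 ht with ht | ht
    · rw [Finset.mem_powersetCard] at ht
      refine ⟨t, ht.1, subset_rfl, fun h => ?_⟩
      have := Finset.card_le_card h
      omega
    · obtain ⟨v, hv, ht⟩ := Finset.mem_biUnion.1 ht
      obtain ⟨y, -, rfl⟩ := Finset.mem_image.1 ht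
      obtain ⟨hvs, hcard⟩ := Finset.mem_powersetCard.1 (hU hv)
      exact ⟨v, hvs, Finset.subset_insert y v, fun h =>
        hu (Finset.eq_of_subset_of_card_le h hcard.ge ▸ hv)⟩
  obtain ⟨k, hk, hku⟩ := Finset.not_subset.1 hvu
  exact ⟨k, Finset.mem_sdiff.2 ⟨hvs hk, hku⟩, Finset.mem_sdiff.2 ⟨hvt hk, hku⟩⟩

namespace HasLinearResolution

variable [DecidableEq σ] {q : ℕ} {b : ℕ → ℕ} {𝒜 : Finset (Finset σ)}

theorem squarefreeIdeal_insert {t V : Finset σ}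
    (h : HasLinearResolution (squarefreeIdeal R 𝒜) q b) (ht : t.card = q)
    (hA : ∀ s ∈ 𝒜, ∃ k ∈ V, k ∈ s \ t) (hV : ∀ k ∈ V, ∃ s ∈ 𝒜, s ⊆ insert k t) :
    HasLinearResolution (squarefreeIdeal R (insert t 𝒜)) q fun i => b i + V.card.choose i := by
  rw [squarefreeIdeal, Finset.coe_insert, Set.image_insert_eq, Ideal.span_insert, sup_comm]
  refine h.sup_span_singleton
    (isHomogeneous_monomial 1 ((degree_squarefreeExponent t).trans ht)) ?_
    (Nat.choose_zero_right _)
  rw [colon_squarefreeIdeal_eq_span_X hA hV]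
  exact hasLinearResolution_span_X V

theorem squarefreeIdeal_union_image_insert {u W Y : Finset σ}
    (h : HasLinearResolution (squarefreeIdeal R 𝒜) (u.card + 1) b)
    (hA : ∀ s ∈ 𝒜, ∃ k ∈ W, k ∈ s \ u) (hW : ∀ k ∈ W, insert k u ∈ 𝒜)
    (hYu : Disjoint Y u) (hYW : Disjoint Y W) :
    HasLinearResolution (squarefreeIdeal R (𝒜 ∪ Y.image (insert · u))) (u.card + 1)
      fun i => b i + ∑ k ∈ Finset.range Y.card, (W.card + k).choose i := by
  induction Y using Finset.induction_on with
  | empty => simpa using h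
  | insert y Y hy ih =>
    rw [Finset.disjoint_insert_left] at hYu hYW
    have key := (ih hYu.2 hYW.2).squarefreeIdeal_insert (t := insert y u) (V := W ∪ Y)
      (Finset.card_insert_of_notMem hYu.1) (by
        intro s hs
        rcases Finset.mem_union.1 hs with hs | hs
        · obtain ⟨k, hk, hks⟩ := hA s hs
          have hky : k ≠ y := fun h => hYW.1 (h ▸ hk)
          exact ⟨k, Finset.mem_union_left _ hk, by simp_all⟩
        · obtain ⟨z, hz, rfl⟩ := Finset.mem_image.1 hs
          have hzy : z ≠ y := fun h => hy (h ▸ hz)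
          have hzu : z ∉ u := Finset.disjoint_left.1 hYu.2 hz
          exact ⟨z, Finset.mem_union_right _ hz, by simp [hzy, hzu]⟩)
      (by
        intro k hk
        refine ⟨insert k u, ?_, Finset.insert_subset_insert _ (Finset.subset_insert _ _)⟩
        rcases Finset.mem_union.1 hk with hk | hk
        · exact Finset.mem_union_left _ (hW k hk)
        · exact Finset.mem_union_right _ (Finset.mem_image_of_mem _ hk))
    rw [Finset.image_insert, Finset.union_insert, Finset.card_insert_of_notMem hy]
    simpa only [Finset.sum_range_succ, ← add_assoc,
      Finset.card_union_of_disjoint hYW.2.symm] using key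

theorem squarefreeIdeal_powersetCard_union {s : Finset σ} {e : ℕ} {U : Finset (Finset σ)}
    {Y : Finset σ → Finset σ}
    (h : HasLinearResolution (squarefreeIdeal R (s.powersetCard (e + 1))) (e + 1) b)
    (hU : U ⊆ s.powersetCard e) (hY : ∀ u ∈ U, Disjoint (Y u) s) :
    HasLinearResolution
      (squarefreeIdeal R (s.powersetCard (e + 1) ∪ U.biUnion fun u => (Y u).image (insert · u)))
      (e + 1) fun i =>
        b i + ∑ u ∈ U, ∑ k ∈ Finset.range (Y u).card, (s.card - e + k).choose i := by
  induction U using Finset.induction_on with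
  | empty => simpa using h
  | insert u U hu ih =>
    rw [Finset.insert_subset_iff, Finset.mem_powersetCard] at hU
    obtain ⟨⟨hus, rfl⟩, hU⟩ := hU
    rw [Finset.forall_mem_insert] at hY
    have key := (ih hU hY.2).squarefreeIdeal_union_image_insert (W := s \ u)
      (fun t ht => exists_mem_sdiff_of_mem_powersetCard_union hU hu ht)
      (by
        intro k hk
        rw [Finset.mem_sdiff] at hk
        exact Finset.mem_union_left _ (Finset.mem_powersetCard.2
          ⟨Finset.insert_subset hk.1 hus, Finset.card_insert_of_notMem hk.2⟩))
      (hY.1.mono_right hus) (hY.1.mono_right Finset.sdiff_subset)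
    rw [Finset.biUnion_insert, Finset.union_comm (Finset.image _ _), ← Finset.union_assoc]
    simpa only [Finset.sum_insert hu, add_assoc, add_comm (∑ _ ∈ Finset.range (Y u).card, _),
      Finset.card_sdiff_of_subset hus] using key

end HasLinearResolution

end SquarefreeIdeal

section Linearization

theorem choose_mul_choose_succ_add (N e i : ℕ) :
    (i + e).choose e * N.choose (i + (e + 1)) + N.choose e * (N - e).choose i =
      (i + e).choose e * (N + 1).choose (i + (e + 1)) := by
  have h : (i + e).choose e * N.choose (i + e) = N.choose e * (N - e).choose i := by
    rw [mul_comm, Nat.choose_mul (Nat.le_add_left e i), Nat.add_sub_cancel]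
  rw [← h, ← mul_add, ← add_assoc, Nat.choose_succ_succ', add_comm (N.choose _)]

theorem hasLinearResolution_squarefreeIdeal_powersetCard {σ R : Type*} [CommRing R]
    (s : Finset σ) (e : ℕ) :
    HasLinearResolution (squarefreeIdeal R (s.powersetCard (e + 1))) (e + 1)
      fun i => (i + e).choose e * s.card.choose (i + (e + 1)) := by
  classical
  induction s using Finset.induction_on with
  | empty =>
    rw [Finset.powersetCard_eq_empty.2 e.succ_pos]
    simpa [squarefreeIdeal, ← add_assoc] using hasLinearResolution_bot (R := R) (σ := σ) (e + 1)
  | insert z s hz ih =>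
    have h := ih.squarefreeIdeal_powersetCard_union (Y := fun _ => {z}) subset_rfl
      fun _ _ => Finset.disjoint_singleton_left.2 hz
    have hunion : s.powersetCard (e + 1) ∪
        ((s.powersetCard e).biUnion fun u => ({z} : Finset σ).image (insert · u)) =
          (insert z s).powersetCard (e + 1) := by
      simp only [Finset.powersetCard_succ_insert hz, Finset.image_singleton,
        Finset.biUnion_singleton]
    simpa only [hunion, Finset.card_insert_of_notMem hz, Finset.card_singleton,
      Finset.sum_range_one, add_zero, Finset.sum_const, Finset.card_powersetCard, smul_eq_mul,
      choose_mul_choose_succ_add] using h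

/-- The generators with supports `g j` that are divisible by the monomial with support `u`. -/
def edgeStar {ι α : Type*} [Fintype ι] [DecidableEq α] (g : ι → Finset α) (u : Finset α) :
    Finset ι :=
  {j | u ⊆ g j}

theorem mem_edgeStar {ι α : Type*} [Fintype ι] [DecidableEq α] {g : ι → Finset α}
    {u : Finset α} {j : ι} : j ∈ edgeStar g u ↔ u ⊆ g j :=
  Finset.mem_filter_univ j

variable {K : Type*} [Field K] {n m e : ℕ} {g : Fin m → Finset (Fin n)}

theorem maxExponent_squarefreeExponent {j : Fin m} (hj : (g j).Nonempty) :
    maxExponent (fun j => squarefreeExponent (g j)) = 1 := by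
  obtain ⟨k, hk⟩ := hj
  refine le_antisymm (Finset.sup_le fun j _ => Finset.sup_le fun k _ =>
    isSquarefreeMonomial_squarefreeExponent (g j) k) ?_
  calc 1 = squarefreeExponent (g j) k := by rw [squarefreeExponent_apply, if_pos hk]
    _ ≤ Finset.univ.sup fun k => squarefreeExponent (g j) k := Finset.le_sup (Finset.mem_univ k)
    _ ≤ _ := Finset.le_sup (f := fun j => Finset.univ.sup fun k => squarefreeExponent (g j) k)
      (Finset.mem_univ j)

theorem completePart_eq_squarefreeIdeal (d : ℕ) {f : Fin m → (Fin n →₀ ℕ)}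
    (hf : maxExponent f = 1) :
    completePart K d f = squarefreeIdeal K ((Finset.univ.map .inl).powersetCard d) := by
  rw [completePart, squarefreeIdeal, Finset.powersetCard_map, Finset.coe_map, Set.image_image, hf]
  congr 1
  ext p
  constructor
  · rintro ⟨a, rfl, ha, rfl⟩
    obtain ⟨s, rfl⟩ := IsSquarefreeMonomial.exists_eq_squarefreeExponent ha
    refine ⟨s, by simp [degree_squarefreeExponent], ?_⟩
    exact congrArg (monomial · 1) (squarefreeExponent_map _ _)
  · rintro ⟨s, hs, rfl⟩
    rw [Finset.mem_coe, Finset.mem_powersetCard_univ] at hs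
    refine ⟨squarefreeExponent s, by rw [degree_squarefreeExponent, hs],
      isSquarefreeMonomial_squarefreeExponent s, ?_⟩
    exact congrArg (monomial · 1) (squarefreeExponent_map _ _)

theorem squarefreeExponent_erase_mapDomain_add_single {k : Fin n} {j : Fin m}
    (hk : k ∈ g j) :
    (squarefreeExponent (g j) - Finsupp.single k 1).mapDomain Sum.inl +
      Finsupp.single (Sum.inr j) 1 =
        squarefreeExponent (insert (Sum.inr j) (((g j).erase k).map .inl)) := by
  have h := squarefreeExponent_insert (Finset.notMem_erase k (g j))
  rw [Finset.insert_erase hk] at h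
  rw [squarefreeExponent_insert (by simp), squarefreeExponent_map, h, add_tsub_cancel_right]
  rfl

theorem lastPart_eq_squarefreeIdeal (hg : ∀ j, (g j).card = e + 1) :
    lastPart K (fun j => squarefreeExponent (g j)) =
      squarefreeIdeal K (((Finset.univ.map .inl).powersetCard e).biUnion fun u =>
        ((edgeStar (fun j => (g j).map .inl) u).map .inr).image (insert · u)) := by
  rw [lastPart, squarefreeIdeal]
  congr 1
  ext p
  simp only [support_squarefreeExponent]
  constructor
  · rintro ⟨j, k, hk, rfl⟩
    rw [squarefreeExponent_erase_mapDomain_add_single hk]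
    refine ⟨_, Finset.mem_biUnion.2 ⟨((g j).erase k).map .inl, ?_, Finset.mem_image.2
      ⟨.inr j, Finset.mem_map_of_mem _ (mem_edgeStar.2 ?_), rfl⟩⟩, rfl⟩
    · rw [Finset.mem_powersetCard, Finset.card_map, Finset.card_erase_of_mem hk, hg,
        Nat.add_sub_cancel]
      exact ⟨Finset.map_subset_map.2 (Finset.subset_univ _), rfl⟩
    · exact Finset.map_subset_map.2 (Finset.erase_subset _ _)
  · rintro ⟨_, hs, rfl⟩
    simp only [Finset.powersetCard_map, Finset.coe_biUnion, Finset.coe_image, Finset.coe_map,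
      Set.mem_iUnion, Set.mem_image, Finset.mem_coe, Finset.mem_powersetCard_univ,
      mem_edgeStar] at hs
    obtain ⟨_, ⟨u, hu, rfl⟩, _, ⟨j, huj, rfl⟩, rfl⟩ := hs
    obtain ⟨k, hku, hk⟩ := Finset.exists_eq_insert_iff.2
      ⟨Finset.map_subset_map.1 huj, by rw [hu, hg]⟩
    have hkj : k ∈ g j := hk ▸ Finset.mem_insert_self k u
    refine ⟨j, k, hkj, ?_⟩
    rw [squarefreeExponent_erase_mapDomain_add_single hkj, ← hk, Finset.erase_insert hku]
    rfl

theorem hasLinearResolution_LIN (hg : ∀ j, (g j).card = e + 1) (j₀ : Fin m) :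
    HasLinearResolution (LIN K (e + 1) fun j => squarefreeExponent (g j)) (e + 1) fun i =>
      (i + e).choose e * n.choose (i + (e + 1)) +
        ∑ u ∈ (Finset.univ : Finset (Fin n)).powersetCard e,
          ∑ k ∈ Finset.range (edgeStar g u).card, (n - e + k).choose i := by
  rw [LIN, lastPart_eq_squarefreeIdeal hg, completePart_eq_squarefreeIdeal (e + 1)
    (maxExponent_squarefreeExponent (Finset.card_pos.1 ((hg j₀).ge.trans' e.succ_pos))),
    ← squarefreeIdeal_union]
  have h := (hasLinearResolution_squarefreeIdeal_powersetCard (R := K)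
    (Finset.univ.map (.inl : Fin n ↪ Fin n ⊕ Fin m)) e).squarefreeIdeal_powersetCard_union
    (Y := fun u => (edgeStar (fun j => (g j).map .inl) u).map .inr) subset_rfl
    fun u _ => by simp [Finset.disjoint_left]
  simpa [Finset.powersetCard_map, edgeStar, -Finset.univ_disjSum_univ] using h

end Linearization

section Clusters

section edgeStar

variable {ι α : Type*} [Fintype ι] [DecidableEq α] {g : ι → Finset α} {e : ℕ}

/- Two distinct generators have at most one common edge, namely the intersection of their
supports. -/
theorem eq_of_edgeStar_subset (hg : Function.Injective g) (hcard : ∀ j, (g j).card = e + 1)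
    {u v : Finset α} (hu : u.card = e) (hv : v.card = e) (h2 : 2 ≤ (edgeStar g u).card)
    (huv : edgeStar g u ⊆ edgeStar g v) : u = v := by
  obtain ⟨i, hi, j, hj, hij⟩ := Finset.one_lt_card.1 h2
  have hint : (g i ∩ g j).card ≤ e := by
    rw [← Nat.lt_succ_iff, Nat.succ_eq_add_one, ← hcard i]
    refine Finset.card_lt_card (Finset.inter_subset_left.ssubset_of_ne fun h => hij (hg ?_))
    exact Finset.eq_of_subset_of_card_le (Finset.inter_eq_left.1 h)
      ((hcard j).trans_le (hcard i).ge)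
  have eq_inter {w : Finset α} (hw : w.card = e) (hi : i ∈ edgeStar g w)
      (hj : j ∈ edgeStar g w) : w = g i ∩ g j :=
    Finset.eq_of_subset_of_card_le
      (Finset.subset_inter (mem_edgeStar.1 hi) (mem_edgeStar.1 hj)) (hint.trans hw.ge)
  rw [eq_inter hu hi hj, eq_inter hv (huv hi) (huv hj)]

theorem eq_edgeStar_of_maximal {B : Finset ι} {u : Finset α} (hu : B ⊆ edgeStar g u)
    (hmax : ∀ C ⊆ edgeStar g u, B ⊆ C → C.card ≠ B.card + 1) : B = edgeStar g u := by
  classical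
  by_contra hne
  obtain ⟨k, hk, hkB⟩ := Finset.exists_of_ssubset (hu.ssubset_of_ne hne)
  exact hmax (insert k B) (Finset.insert_subset hk hu) (Finset.subset_insert k B)
    (Finset.card_insert_of_notMem hkB)

end edgeStar

variable {K : Type*} [Field K] {n m e : ℕ} {I : Ideal (MvPolynomial (Fin n) K)}
  {g : Fin m → Finset (Fin n)}

theorem isEdge_iff (hgI : Set.range (fun j => squarefreeExponent (g j)) = minGens I)
    {u : Finset (Fin n)} : IsEdge I (e + 1) (squarefreeExponent u) ↔
      u.card = e ∧ (edgeStar g u).Nonempty := by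
  simp [IsEdge, isSquarefreeMonomial_squarefreeExponent, degree_squarefreeExponent, ← hgI,
    squarefreeExponent_le_squarefreeExponent_iff, Finset.Nonempty, mem_edgeStar]

theorem isCluster_image_iff (hg : Function.Injective g)
    (hgI : Set.range (fun j => squarefreeExponent (g j)) = minGens I) {j : ℕ} (hj : 0 < j)
    {B : Finset (Fin m)} :
    IsCluster I (e + 1) j (B.image fun k => squarefreeExponent (g k)) ↔
      B.card = j ∧ ∃ u, u.card = e ∧ B ⊆ edgeStar g u := by
  have hsub : ((B.image fun k => squarefreeExponent (g k) : Finset _) : Set (Fin n →₀ ℕ)) ⊆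
      minGens I := by
    rw [Finset.coe_image, ← hgI]
    exact Set.image_subset_range _ _
  have hle {u : Finset (Fin n)} : (∀ s ∈ B.image fun k => squarefreeExponent (g k),
      squarefreeExponent u ≤ s) ↔ B ⊆ edgeStar g u := by
    rw [Finset.forall_mem_image]
    exact forall₂_congr fun _ _ =>
      squarefreeExponent_le_squarefreeExponent_iff.trans mem_edgeStar.symm
  have hinj : Function.Injective fun k => squarefreeExponent (g k) :=
    squarefreeExponent_injective.comp hg
  rw [IsCluster, Finset.card_image_of_injective _ hinj]
  constructor
  · rintro ⟨-, hB, u, hu, huB⟩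
    obtain ⟨u, rfl⟩ := hu.1.exists_eq_squarefreeExponent
    exact ⟨hB, u, ((isEdge_iff hgI).1 hu).1, hle.1 huB⟩
  · rintro ⟨rfl, u, hu, huB⟩
    exact ⟨hsub, rfl, _, (isEdge_iff hgI).2 ⟨hu, (Finset.card_pos.1 hj).mono huB⟩, hle.2 huB⟩

theorem isCluster_and_maximal_image_iff (hg : Function.Injective g)
    (hcard : ∀ j, (g j).card = e + 1)
    (hgI : Set.range (fun j => squarefreeExponent (g j)) = minGens I) {j : ℕ} (hj : 2 ≤ j)
    {B : Finset (Fin m)} : (IsCluster I (e + 1) j (B.image fun k => squarefreeExponent (g k)) ∧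
        ¬ ∃ C : Finset (Fin m), IsCluster I (e + 1) (j + 1)
            (C.image fun k => squarefreeExponent (g k)) ∧ B ⊆ C) ↔
      ∃ u, (u.card = e ∧ (edgeStar g u).card = j) ∧ edgeStar g u = B := by
  simp only [isCluster_image_iff hg hgI (zero_lt_two.trans_le hj),
    isCluster_image_iff hg hgI j.succ_pos]
  constructor
  · rintro ⟨⟨rfl, u, hu, hBu⟩, hmax⟩
    have h := eq_edgeStar_of_maximal hBu fun C hCu hBC hC => hmax ⟨C, ⟨hC, u, hu, hCu⟩, hBC⟩
    exact ⟨u, ⟨hu, by rw [← h]⟩, h.symm⟩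
  · rintro ⟨u, ⟨hu, rfl⟩, rfl⟩
    refine ⟨⟨rfl, u, hu, subset_rfl⟩, ?_⟩
    rintro ⟨C, ⟨hC, v, hv, hCv⟩, huC⟩
    obtain rfl := eq_of_edgeStar_subset hg hcard hu hv hj (huC.trans hCv)
    have := Finset.card_le_card hCv
    omega

theorem IsCluster.exists_eq_image
    (hgI : Set.range (fun j => squarefreeExponent (g j)) = minGens I) {d j : ℕ}
    {A : Finset (Fin n →₀ ℕ)} (hA : IsCluster I d j A) :
    ∃ B : Finset (Fin m), A = B.image fun k => squarefreeExponent (g k) := by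
  have h := hA.1
  rw [← hgI, ← Set.image_univ, Finset.subset_set_image_iff] at h
  obtain ⟨B, -, hB⟩ := h
  exact ⟨B, hB.symm⟩

theorem numMaxClusters_eq_card (hg : Function.Injective g) (hcard : ∀ j, (g j).card = e + 1)
    (hgI : Set.range (fun j => squarefreeExponent (g j)) = minGens I) {j : ℕ} (hj : 2 ≤ j) :
    numMaxClusters I (e + 1) j =
      ((Finset.univ.powersetCard e).filter fun u => (edgeStar g u).card = j).card := by
  have hinj : Function.Injective fun k => squarefreeExponent (g k) :=
    squarefreeExponent_injective.comp hg
  have hset : {A : Finset (Fin n →₀ ℕ) | IsCluster I (e + 1) j A ∧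
      ¬ ∃ C, IsCluster I (e + 1) (j + 1) C ∧ A ⊆ C} =
      (fun u => (edgeStar g u).image fun k => squarefreeExponent (g k)) ''
        ((Finset.univ.powersetCard e).filter fun u => (edgeStar g u).card = j) := by
    have key {B : Finset (Fin m)} := isCluster_and_maximal_image_iff hg hcard hgI hj (B := B)
    simp only [Finset.coe_filter, Finset.mem_powersetCard_univ]
    ext A
    constructor
    · rintro ⟨hA, hmax⟩
      obtain ⟨B, rfl⟩ := hA.exists_eq_image hgI
      obtain ⟨u, hu, rfl⟩ := key.1
        ⟨hA, fun ⟨C, hC, hBC⟩ => hmax ⟨_, hC, Finset.image_subset_image hBC⟩⟩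
      exact ⟨u, hu, rfl⟩
    · rintro ⟨u, hu, rfl⟩
      obtain ⟨hA, hmax⟩ := key.2 ⟨u, hu, rfl⟩
      refine ⟨hA, fun ⟨C, hC, hsub⟩ => ?_⟩
      obtain ⟨C, rfl⟩ := hC.exists_eq_image hgI
      exact hmax ⟨C, hC, (Finset.image_subset_image_iff hinj).1 hsub⟩
  rw [numMaxClusters, hset, Set.InjOn.ncard_image, Set.ncard_coe_finset]
  intro u hu v hv huv
  simp only [Finset.coe_filter, Finset.mem_powersetCard_univ, Set.mem_ofPred_eq] at hu hv
  exact eq_of_edgeStar_subset hg hcard hu.1 hv.1 (hj.trans hu.2.ge)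
    (Finset.image_injective hinj huv).le

theorem exists_squarefreeExponent_family {ι σ : Type*} {d : ℕ} {f : ι → (σ →₀ ℕ)}
    (hf : Function.Injective f) (hsq : ∀ j, IsSquarefreeMonomial (f j))
    (hdeg : ∀ j, (f j).degree = d) :
    ∃ g : ι → Finset σ, (fun j => squarefreeExponent (g j)) = f ∧
      Function.Injective g ∧ ∀ j, (g j).card = d := by
  choose g hg using fun j => (hsq j).exists_eq_squarefreeExponent
  obtain rfl : f = fun j => squarefreeExponent (g j) := funext hg
  exact ⟨g, rfl, Function.Injective.of_comp (f := squarefreeExponent) hf, fun j => by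
    rw [← hdeg j, degree_squarefreeExponent]⟩

theorem nonempty_minGens {σ : Type*} {J : Ideal (MvPolynomial σ K)} (hJ : IsMonomialIdeal J)
    (hJ0 : J ≠ ⊥) : (minGens J).Nonempty := by
  obtain ⟨S, rfl⟩ := hJ
  obtain ⟨s, hs⟩ : S.Nonempty := by
    contrapose! hJ0
    simp [hJ0]
  obtain ⟨t, -, ht⟩ := exists_minimal_le_of_wellFoundedLT
    (fun t : σ →₀ ℕ => monomial t (1 : K) ∈
      Ideal.span ((fun s => monomial s (1 : K)) '' S)) s (Ideal.subset_span ⟨s, hs, rfl⟩)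
  exact ⟨t, ht⟩

end Clusters

section Counting

theorem sum_range_add_one_eq (c : ℕ → ℤ) (D : ℕ) :
    ∑ k ∈ Finset.range D, c (k + 1) = D * c 1 + ∑ k ∈ Finset.Icc 2 D, (c k - c 1) := by
  induction D with
  | zero => simp
  | succ D ih =>
    rw [Finset.sum_range_succ, ih]
    rcases D with _ | D
    · simp
    · rw [Finset.sum_Icc_succ_top (b := D + 1) (by omega)]
      push_cast
      ring

theorem sum_comp_eq_sum_card_mul {α : Type*} {U : Finset α} {D : α → ℕ} {m : ℕ}
    (hD : ∀ u ∈ U, D u ≤ m) {W : ℕ → ℤ} (h₀ : W 0 = 0) (h₁ : W 1 = 0) :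
    ∑ u ∈ U, W (D u) = ∑ j ∈ Finset.Icc 2 m, ((U.filter fun u => D u = j).card : ℤ) * W j := by
  rw [← Finset.sum_fiberwise_of_maps_to' (t := Finset.Icc 0 m)
    fun u hu => Finset.mem_Icc.2 ⟨Nat.zero_le _, hD u hu⟩]
  simp only [Finset.sum_const, nsmul_eq_mul]
  refine (Finset.sum_subset (Finset.Icc_subset_Icc_left (Nat.zero_le 2)) fun j hj hj' => ?_).symm
  obtain rfl | rfl : j = 0 ∨ j = 1 := by
    rw [Finset.mem_Icc] at hj hj'
    omega
  · rw [h₀, mul_zero]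
  · rw [h₁, mul_zero]

theorem sum_sum_range_add_one_eq {α : Type*} {U : Finset α} {D : α → ℕ} {m : ℕ}
    (hD : ∀ u ∈ U, D u ≤ m) (c : ℕ → ℤ) :
    ∑ u ∈ U, ∑ k ∈ Finset.range (D u), c (k + 1) =
      c 1 * (∑ u ∈ U, (D u : ℤ) -
        ∑ j ∈ Finset.Icc 2 m, ((j : ℤ) - 1) * ((U.filter fun u => D u = j).card : ℤ)) +
      ∑ j ∈ Finset.Icc 2 m, ((U.filter fun u => D u = j).card : ℤ) *
        ∑ k ∈ Finset.Icc 2 j, c k := by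
  have hW (j : ℕ) (hj : j ∈ Finset.Icc 2 m) :
      ∑ k ∈ Finset.Icc 2 j, (c k - c 1) = ∑ k ∈ Finset.Icc 2 j, c k - (j - 1) * c 1 := by
    have hcard : ((Finset.Icc 2 j).card : ℤ) = j - 1 := by
      rw [Nat.card_Icc]
      have := (Finset.mem_Icc.1 hj).1
      omega
    rw [Finset.sum_sub_distrib, Finset.sum_const, nsmul_eq_mul, hcard]
  have hsub : ∑ j ∈ Finset.Icc 2 m, ((U.filter fun u => D u = j).card : ℤ) *
        ∑ k ∈ Finset.Icc 2 j, (c k - c 1) =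
      ∑ j ∈ Finset.Icc 2 m, ((U.filter fun u => D u = j).card : ℤ) * ∑ k ∈ Finset.Icc 2 j, c k -
        c 1 * ∑ j ∈ Finset.Icc 2 m,
          ((j : ℤ) - 1) * ((U.filter fun u => D u = j).card : ℤ) := by
    rw [Finset.mul_sum, ← Finset.sum_sub_distrib]
    refine Finset.sum_congr rfl fun j hj => ?_
    rw [hW j hj]
    ring
  simp only [sum_range_add_one_eq]
  rw [Finset.sum_add_distrib, sum_comp_eq_sum_card_mul hD
    (W := fun j => ∑ k ∈ Finset.Icc 2 j, (c k - c 1)) (by simp) (by simp), hsub, ← Finset.sum_mul]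
  ring

theorem sum_card_edgeStar {ι α : Type*} [Fintype ι] [Fintype α] [DecidableEq α]
    {g : ι → Finset α} {e : ℕ} (hg : ∀ j, (g j).card = e + 1) :
    ∑ u ∈ Finset.univ.powersetCard e, (edgeStar g u).card = Fintype.card ι * (e + 1) := by
  have hbelow (j : ι) : (Finset.univ.powersetCard e).bipartiteBelow (fun u j => u ⊆ g j) j =
      (g j).powersetCard e := by
    ext u
    simp [Finset.mem_bipartiteBelow, Finset.mem_powersetCard, and_comm]
  calc ∑ u ∈ Finset.univ.powersetCard e, (edgeStar g u).card
      = ∑ j, ((Finset.univ.powersetCard e).bipartiteBelow (fun u j => u ⊆ g j) j).card :=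
        Finset.sum_card_bipartiteAbove_eq_sum_card_bipartiteBelow _
    _ = Fintype.card ι * (e + 1) := by
        simp [hbelow, hg, Nat.choose_succ_self_right]

theorem sum_sum_range_card_edgeStar_eq {K : Type*} [Field K] {n m e : ℕ}
    {I : Ideal (MvPolynomial (Fin n) K)} {g : Fin m → Finset (Fin n)}
    (hg : Function.Injective g) (hcard : ∀ j, (g j).card = e + 1)
    (hgI : Set.range (fun j => squarefreeExponent (g j)) = minGens I) (c : ℕ → ℤ) :
    ∑ u ∈ Finset.univ.powersetCard e, ∑ k ∈ Finset.range (edgeStar g u).card, c (k + 1) =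
      c 1 * (m * (e + 1 : ℕ) -
        ∑ j ∈ Finset.Icc 2 m, ((j : ℤ) - 1) * (numMaxClusters I (e + 1) j : ℤ)) +
      ∑ j ∈ Finset.Icc 2 m, (numMaxClusters I (e + 1) j : ℤ) * ∑ k ∈ Finset.Icc 2 j, c k := by
  have hle (u : Finset (Fin n)) : (edgeStar g u).card ≤ m :=
    (Finset.card_le_univ _).trans_eq (Fintype.card_fin m)
  have hC {a : ℕ → ℤ → ℤ} : ∑ j ∈ Finset.Icc 2 m, a j (numMaxClusters I (e + 1) j) =
      ∑ j ∈ Finset.Icc 2 m,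
        a j ((Finset.univ.powersetCard e).filter fun u => (edgeStar g u).card = j).card :=
    Finset.sum_congr rfl fun j hj => by
      rw [numMaxClusters_eq_card hg hcard hgI (Finset.mem_Icc.1 hj).1]
  rw [sum_sum_range_add_one_eq fun u _ => hle u, ← Nat.cast_sum, sum_card_edgeStar hcard,
    Fintype.card_fin, Nat.cast_mul, hC (a := fun j N => (j - 1) * N),
    hC (a := fun j N => N * ∑ k ∈ Finset.Icc 2 j, c k)]

end Counting

end StarLinearization

end

open StarLinearization in
/-- `I` is a nonzero squarefree monomial ideal of `K[x₁, …, xₙ]` with minimal monomial generators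
`f 0, …, f (m - 1)`, all of degree `d ≥ 1`. The ideal `LIN(I)` has a minimal graded free
resolution, and in each of them the `i`-th total Betti number is the given one. Sums over `j ≥ 2`
stop at `m`, since a set of generators has at most `m` elements. -/
theorem corollary4p8 {K : Type*} [Field K] {n m d : ℕ} (hd : 1 ≤ d)
    (I : Ideal (MvPolynomial (Fin n) K)) (hI : IsMonomialIdeal I) (hI0 : I ≠ ⊥)
    (f : Fin m → (Fin n →₀ ℕ)) (hf : Function.Injective f) (hfI : Set.range f = minGens I)
    (hsq : ∀ s ∈ minGens I, IsSquarefreeMonomial s)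
    (hdeg : ∀ s ∈ minGens I, s.degree = d) :
    Nonempty (MinimalGradedFreeResolution (LIN K d f)) ∧
    ∀ (F : MinimalGradedFreeResolution (LIN K d f)) (i : ℕ),
      (F.totalBetti i : ℤ) =
        ((i + d - 1).choose (d - 1) : ℤ) * (n.choose (i + d) : ℤ)
        + ((n - d + 1).choose i : ℤ) *
            ((m : ℤ) * d - ∑ j ∈ Finset.Icc 2 m, ((j : ℤ) - 1) * (numMaxClusters I d j : ℤ))
        + ∑ j ∈ Finset.Icc 2 m, (numMaxClusters I d j : ℤ) *
            ∑ k ∈ Finset.Icc 2 j, ((n - d + k).choose i : ℤ) := by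
  obtain ⟨e, rfl⟩ := Nat.exists_eq_add_of_le' hd
  obtain ⟨g, rfl, hg, hcard⟩ := exists_squarefreeExponent_family hf
    (fun j => hsq _ (hfI.le ⟨j, rfl⟩)) fun j => hdeg _ (hfI.le ⟨j, rfl⟩)
  obtain ⟨s, hs⟩ := nonempty_minGens hI hI0
  obtain ⟨j₀, -⟩ := hfI.ge hs
  obtain ⟨hne, hbetti⟩ := (hasLinearResolution_LIN (K := K) hcard j₀).nonempty_and_totalBetti_eq
  refine ⟨hne, fun F i => ?_⟩
  have hn (k : ℕ) : n - e + k = n - (e + 1) + (k + 1) := by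
    have := (hcard j₀).symm.trans_le ((Finset.card_le_univ _).trans_eq (Fintype.card_fin n))
    omega
  have hsum := sum_sum_range_card_edgeStar_eq hg hcard hfI
    fun k => ((n - (e + 1) + k).choose i : ℤ)
  rw [hbetti, add_assoc, ← hsum]
  push_cast [hn]
  rfl
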